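/- (Ax's theorem.) Let $p$ be a prime, $q=p^e$ with $e\ge 1$, let $\mathbb{F}_q$ be the finite field with $q$ elements, and let $k\ge 1$ and $d\ge 1$ be integers. For $f\in\mathbb{F}_q[x_1,\ldots,x_k]$ let $N(f=0)$ denote the number of points $x\in\mathbb{F}_q^k$ with $f(x)=0$. Then for every polynomial $f\in\mathbb{F}_q[x_1,\ldots,x_k]$ of total degree $d$, the number $N(f=0)$ is divisible by $q^{\lceil k/d\rceil-1}$. Furthermore, there exists a polynomial $f\in\mathbb{F}_q[x_1,\ldots,x_k]$ of total degree $d$ for which this is sharp, in the sense that the exact power of $p$ dividing $N(f=0)$ is $q^{\lceil k/d\rceil-1}$, i.e. $N(f=0)\neq 0$ and $\nu_p(N(f=0))=e(\lceil k/d\rceil-1)$. -/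

import Mathlib

/-- `N(f = 0)`: the number of points `x ∈ F^k` with `f(x) = 0`. -/
noncomputable def numZeros {F : Type*} [Field F] {k : ℕ} (f : MvPolynomial (Fin k) F) : ℕ :=
  Nat.card {x : Fin k → F // MvPolynomial.eval x f = 0}

/-! Write q = p^e and r = ⌈k/d⌉. Lift f to T(x) in the Witt vectors, termwise by Teichmüller. Modulo
p^n, 1 - T(x)^((q-1)p^n) is the indicator of f(x) = 0, so N is a sum of such powers. Multinomial
expansion leaves terms multinomial(j) · ∏_l ∑_t τ(t)^(n_l), which vanish unless q-1 divides every
n_l, and gain a factor q for each n_l = 0. Legendre's formula turns the valuation of the multinomial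
into digit sums of j, bounded below by averaging over the e cyclic digit rotations
(`le_sum_digits_sum`).

Sharpness: for ∑ y_i ∏_j z_ij with r variables y_i, the fibre over z is a hyperplane unless all
coefficients vanish. Hence N is q^(r-1) times a number that is prime to p. -/

open Finset

/-! ### Digit sums and multinomial coefficients -/

/-- Cyclic rotations of the base `p` digits of `j`, with positions read modulo `e`. -/
theorem exists_digit_rotation {p e : ℕ} (hp : 1 < p) (j : ℕ) :
    ∃ ρ : ℕ → ℕ, (∀ h, ρ (h + e) = ρ h) ∧ (∀ h, ρ h ≡ p ^ h * j [MOD p ^ e - 1]) ∧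
      (∀ h, 0 < j → 0 < ρ h) ∧
      (p - 1) * ∑ h ∈ range e, ρ h = (p.digits j).sum * (p ^ e - 1) := by
  induction j using Nat.strong_induction_on with
  | _ j ih =>
    rcases Nat.eq_zero_or_pos j with rfl | hj
    · exact ⟨fun _ => 0, by simp, by simp [Nat.ModEq.refl], by simp, by simp⟩
    obtain ⟨ρ, hper, hmod, hpos, hsum⟩ := ih (j / p) (Nat.div_lt_self hj hp)
    have hpe : 1 ≤ p ^ e := Nat.one_le_pow _ _ (by omega)
    have hone : p ^ e ≡ 1 [MOD p ^ e - 1] := by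
      have := (Nat.modEq_iff_dvd' (n := p ^ e - 1) hpe).2 dvd_rfl
      exact this.symm
    -- The lowest digit goes to position h mod e; the digits of j / p sit one place higher, hence
    -- the shift h + 1.
    refine ⟨fun h => j % p * p ^ (h % e) + ρ (h + 1), fun h => ?_, fun h => ?_, fun h _ => ?_, ?_⟩
    · have : h + e + 1 = h + 1 + e := by ring
      simp only [Nat.add_mod_right, this, hper]
    · have hpow : p ^ h ≡ p ^ (h % e) [MOD p ^ e - 1] := by
        conv_lhs => rw [← Nat.div_add_mod h e, pow_add, pow_mul]
        simpa using (hone.pow (h / e)).mul_right (p ^ (h % e))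
      calc j % p * p ^ (h % e) + ρ (h + 1)
          ≡ j % p * p ^ h + p ^ (h + 1) * (j / p) [MOD p ^ e - 1] :=
            (hpow.symm.mul_left _).add (hmod _)
        _ = p ^ h * (j % p + p * (j / p)) := by ring
        _ = p ^ h * j := by rw [Nat.mod_add_div]
    · rcases Nat.eq_zero_or_pos (j % p) with h0 | h0
      · have : 0 < j / p := Nat.div_pos (Nat.le_of_dvd hj (Nat.dvd_of_mod_eq_zero h0)) (by omega)
        exact Nat.add_pos_right _ (hpos (h + 1) this)
      · exact Nat.add_pos_left (Nat.mul_pos h0 (Nat.pow_pos (by omega))) _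
    · have hshift : ∑ h ∈ range e, ρ (h + 1) = ∑ h ∈ range e, ρ h := by
        have h1 := sum_range_succ ρ e
        have h2 := sum_range_succ' ρ e
        have h3 : ρ e = ρ 0 := by simpa using hper 0
        omega
      have hgeom : (p - 1) * ∑ h ∈ range e, p ^ (h % e) = p ^ e - 1 := by
        rw [sum_congr rfl fun h hh => by rw [Nat.mod_eq_of_lt (mem_range.1 hh)], mul_comm,
          Nat.geomSum_eq hp, Nat.div_mul_cancel]
        simpa using Nat.sub_dvd_pow_sub_pow p 1 e
      rw [sum_add_distrib, mul_add, hshift, hsum, ← mul_sum, mul_left_comm, hgeom,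
        Nat.digits_def' hp hj, List.sum_cons, add_mul]

/-- The hypothesis `hr` encodes r ≤ ⌈k/d⌉. Each rotation preserves both divisibilities, and a
nonzero column, being positive, is at least q-1; summing the columns bounds their number by d times
the total. Adding over the e rotations recovers the digit sums. -/
theorem le_sum_digits_sum {ι : Type*} {p e k d : ℕ} (hp : 1 < p) (he : 0 < e) (hd : 1 ≤ d)
    (s : Finset ι) (u : ι → Fin k → ℕ) (hu : ∀ i ∈ s, ∑ l, u i l ≤ d) (j : ι → ℕ)
    (hj : p ^ e - 1 ∣ ∑ i ∈ s, j i) (hl : ∀ l, p ^ e - 1 ∣ ∑ i ∈ s, j i * u i l)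
    (r : ℕ) (hr : ∀ c, k ≤ d * c → r ≤ c) :
    (p - 1) * (e * r) ≤ ∑ i ∈ s, (p.digits (j i)).sum +
      (p - 1) * (e * #{l : Fin k | ∑ i ∈ s, j i * u i l = 0}) := by
  choose ρ _ hmod hpos hsum using fun i => exists_digit_rotation (e := e) hp (j i)
  set Z := #{l : Fin k | ∑ i ∈ s, j i * u i l = 0} with hZ
  have hQ : 0 < p ^ e - 1 := by
    have := Nat.one_lt_pow he.ne' hp
    omega
  have key : ∀ h, (p ^ e - 1) * r ≤ ∑ i ∈ s, ρ i h + (p ^ e - 1) * Z := by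
    intro h
    have hdvd : p ^ e - 1 ∣ ∑ i ∈ s, ρ i h := by
      have : ∑ i ∈ s, ρ i h ≡ ∑ i ∈ s, p ^ h * j i [MOD p ^ e - 1] :=
        Nat.ModEq.sum fun i _ => hmod i h
      rw [← mul_sum] at this
      exact (this.dvd_iff dvd_rfl).2 (hj.mul_left _)
    obtain ⟨c, hc⟩ := hdvd
    have hcol : ∀ l, ∑ i ∈ s, j i * u i l ≠ 0 → p ^ e - 1 ≤ ∑ i ∈ s, ρ i h * u i l := by
      intro l h0
      have hm : ∑ i ∈ s, ρ i h * u i l ≡ ∑ i ∈ s, p ^ h * j i * u i l [MOD p ^ e - 1] :=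
        Nat.ModEq.sum fun i _ => (hmod i h).mul_right _
      simp only [mul_assoc] at hm
      rw [← mul_sum] at hm
      refine Nat.le_of_dvd ?_ ((hm.dvd_iff dvd_rfl).2 ((hl l).mul_left _))
      obtain ⟨i, hi, hi0⟩ := exists_ne_zero_of_sum_ne_zero h0
      have h1 : 0 < j i := Nat.pos_of_ne_zero (left_ne_zero_of_mul hi0)
      have h2 : 0 < u i l := Nat.pos_of_ne_zero (right_ne_zero_of_mul hi0)
      exact sum_pos' (fun _ _ => Nat.zero_le _) ⟨i, hi, Nat.mul_pos (hpos i h h1) h2⟩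
    have hcard : Z + #{l : Fin k | ∑ i ∈ s, j i * u i l ≠ 0} = k := by
      rw [hZ, card_filter_add_card_filter_not, card_univ, Fintype.card_fin]
    have hlow : #{l : Fin k | ∑ i ∈ s, j i * u i l ≠ 0} * (p ^ e - 1) ≤ d * ∑ i ∈ s, ρ i h := by
      calc _ ≤ ∑ l ∈ {l : Fin k | ∑ i ∈ s, j i * u i l ≠ 0}, ∑ i ∈ s, ρ i h * u i l := by
            rw [← smul_eq_mul]
            exact card_nsmul_le_sum _ _ _ fun l hl => hcol l (mem_filter.1 hl).2
        _ ≤ ∑ l, ∑ i ∈ s, ρ i h * u i l :=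
            sum_le_sum_of_subset (filter_subset _ _)
        _ = ∑ i ∈ s, ρ i h * ∑ l, u i l := by
            rw [sum_comm]
            exact sum_congr rfl fun i _ => (mul_sum _ _ _).symm
        _ ≤ ∑ i ∈ s, ρ i h * d := sum_le_sum fun i hi => Nat.mul_le_mul_left _ (hu i hi)
        _ = d * ∑ i ∈ s, ρ i h := by rw [← sum_mul, mul_comm]
    have hdc : #{l : Fin k | ∑ i ∈ s, j i * u i l ≠ 0} ≤ d * c := by
      rw [hc] at hlow
      refine Nat.le_of_mul_le_mul_right (hlow.trans_eq ?_) hQ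
      ring
    -- k ≤ dc + Z ≤ d(c + Z).
    have hrc : r ≤ c + Z := hr _ (by nlinarith [Nat.mul_le_mul_right Z hd])
    rw [hc, ← mul_add]
    exact Nat.mul_le_mul_left _ hrc
  have htot : e * ((p ^ e - 1) * r) ≤
      ∑ i ∈ s, ∑ h ∈ range e, ρ i h + e * ((p ^ e - 1) * Z) := by
    have := sum_le_sum fun h (_ : h ∈ range e) => key h
    rw [sum_add_distrib, sum_comm] at this
    simpa using this
  have hdig : (p - 1) * ∑ i ∈ s, ∑ h ∈ range e, ρ i h =
      (∑ i ∈ s, (p.digits (j i)).sum) * (p ^ e - 1) := by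
    rw [mul_sum, sum_mul]
    exact sum_congr rfl fun i _ => hsum i
  refine Nat.le_of_mul_le_mul_right ?_ hQ
  calc (p - 1) * (e * r) * (p ^ e - 1) = (p - 1) * (e * ((p ^ e - 1) * r)) := by ring
    _ ≤ (p - 1) * (∑ i ∈ s, ∑ h ∈ range e, ρ i h + e * ((p ^ e - 1) * Z)) :=
        Nat.mul_le_mul_left _ htot
    _ = _ := by
        rw [mul_add, hdig]
        ring

theorem digits_sum_pow_sub_one {p : ℕ} (hp : 1 < p) (e : ℕ) :
    (p.digits (p ^ e - 1)).sum = (p - 1) * e := by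
  induction e with
  | zero => simp
  | succ e ih =>
    have h1 : 1 ≤ p ^ e := Nat.one_le_pow _ _ (by omega)
    have : p ^ (e + 1) - 1 = (p - 1) + p * (p ^ e - 1) := by
      rw [Nat.mul_sub, pow_succ']
      have := Nat.mul_le_mul_left p h1
      omega
    rw [this, Nat.digits_add p hp _ _ (by omega) (by omega), List.sum_cons, ih]
    ring

theorem digits_sum_mul_pow {p : ℕ} (hp : 1 < p) (m n : ℕ) :
    (p.digits (m * p ^ n)).sum = (p.digits m).sum := by
  rcases Nat.eq_zero_or_pos m with rfl | hm
  · simp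
  induction n with
  | zero => simp
  | succ n ih =>
    have : m * p ^ (n + 1) = p * (m * p ^ n) := by ring
    rw [this, Nat.digits_base_mul hp (Nat.mul_pos hm (Nat.pow_pos (by omega))), List.sum_cons, ih,
      zero_add]

/-- Legendre's formula applied to each factorial in the multinomial. -/
theorem sum_digits_sum_eq {ι : Type*} {p : ℕ} [hp : Fact p.Prime] (s : Finset ι) (j : ι → ℕ) :
    ∑ i ∈ s, (p.digits (j i)).sum =
      (p - 1) * padicValNat p (Nat.multinomial s j) + (p.digits (∑ i ∈ s, j i)).sum := by
  have hleg : ∀ n, (p - 1) * padicValNat p n.factorial + (p.digits n).sum = n := fun n => by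
    rw [sub_one_mul_padicValNat_factorial, Nat.sub_add_cancel (Nat.digit_sum_le p n)]
  have hval : ∑ i ∈ s, padicValNat p (j i).factorial + padicValNat p (Nat.multinomial s j) =
      padicValNat p (∑ i ∈ s, j i).factorial := by
    have hne : ∏ i ∈ s, (j i).factorial ≠ 0 := prod_ne_zero_iff.2 fun i _ => Nat.factorial_ne_zero _
    have hm : Nat.multinomial s j ≠ 0 := (Nat.multinomial_pos s j).ne'
    rw [← Nat.multinomial_spec s j, padicValNat.mul hne hm]
    congr 1
    clear hne hm
    classical
    induction s using Finset.induction_on with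
    | empty => simp
    | insert a s ha ih =>
      rw [sum_insert ha, prod_insert ha, padicValNat.mul (Nat.factorial_ne_zero _)
        (prod_ne_zero_iff.2 fun i _ => Nat.factorial_ne_zero _), ih]
  have h1 := hleg (∑ i ∈ s, j i)
  have h2 : (p - 1) * ∑ i ∈ s, padicValNat p (j i).factorial + ∑ i ∈ s, (p.digits (j i)).sum =
      ∑ i ∈ s, j i := by
    rw [mul_sum, ← sum_add_distrib]
    exact sum_congr rfl fun i _ => hleg _
  rw [← hval, mul_add] at h1
  omega

theorem pow_dvd_multinomial_mul {ι : Type*} {p e k d n : ℕ} [hp : Fact p.Prime] (he : 0 < e)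
    (hd : 1 ≤ d) (s : Finset ι) (u : ι → Fin k → ℕ) (hu : ∀ i ∈ s, ∑ l, u i l ≤ d) (j : ι → ℕ)
    (hj : ∑ i ∈ s, j i = (p ^ e - 1) * p ^ n) (hl : ∀ l, p ^ e - 1 ∣ ∑ i ∈ s, j i * u i l)
    (r : ℕ) (hr : ∀ c, k ≤ d * c → r ≤ c) :
    p ^ (e * (r - 1)) ∣ Nat.multinomial s j *
      (p ^ e) ^ #{l : Fin k | ∑ i ∈ s, j i * u i l = 0} := by
  have hp1 := hp.out.one_lt
  have h := le_sum_digits_sum hp1 he hd s u hu j (hj ▸ dvd_mul_right _ _) hl r hr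
  -- The exponent (q-1)p^n has digit sum (p-1)e; this is the loss of 1 in r - 1.
  rw [sum_digits_sum_eq, hj, digits_sum_mul_pow hp1, digits_sum_pow_sub_one hp1, ← mul_add,
    ← mul_add] at h
  have h := Nat.le_of_mul_le_mul_left h (by omega)
  rw [← pow_mul]
  refine (pow_dvd_pow p ?_).trans
    ((pow_add p (padicValNat p (Nat.multinomial s j)) _).dvd.trans
      (mul_dvd_mul_right pow_padicValNat_dvd _))
  rw [Nat.mul_sub]
  omega

/-! ### Teichmüller power sums in Witt vectors -/

section Witt

variable {p : ℕ} [hp : Fact p.Prime] {F : Type*} [Field F]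

theorem WittVector.teichmuller_injective :
    Function.Injective (WittVector.teichmuller p : F →* WittVector p F) := fun a b h => by
  rw [← WittVector.teichmuller_coeff_zero p a, h, WittVector.teichmuller_coeff_zero]

theorem WittVector.sum_prod_teichmuller_pow [Fintype F] {k : ℕ} (n : Fin k → ℕ) :
    ∑ x : Fin k → F, ∏ l, WittVector.teichmuller p (x l) ^ n l =
      ∏ l, ∑ t : F, WittVector.teichmuller p t ^ n l := by
  rw [prod_univ_sum, Fintype.piFinset_univ]

/-- With exponent 0 every t contributes 1, including t = 0, so the inner sum is q. -/
theorem WittVector.card_pow_dvd_prod_sum_teichmuller_pow [Fintype F] {k : ℕ} (n : Fin k → ℕ) :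
    (Fintype.card F : WittVector p F) ^ #{l | n l = 0} ∣
      ∏ l, ∑ t : F, WittVector.teichmuller p t ^ n l := by
  rw [← prod_filter_mul_prod_filter_not univ (fun l => n l = 0)]
  refine Dvd.dvd.mul_right ?_ _
  rw [prod_congr rfl fun l hl => by rw [(mem_filter.1 hl).2]]
  simp

variable [CharP F p]

theorem WittVector.natCast_prime_dvd_iff [PerfectRing F p] (x : WittVector p F) :
    (p : WittVector p F) ∣ x ↔ WittVector.constantCoeff x = 0 := by
  rw [← Ideal.mem_span_singleton, ← WittVector.ker_constantCoeff, RingHom.mem_ker]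

/-- Reduction to F gives p ∣ N; then p cancels because the Witt vectors form a domain in which p ≠
0. -/
theorem WittVector.pow_dvd_of_pow_dvd_natCast {a N : ℕ}
    (h : (p : WittVector p F) ^ a ∣ (N : WittVector p F)) : p ^ a ∣ N := by
  induction a generalizing N with
  | zero => simp
  | succ a ih =>
    obtain ⟨w, hw⟩ := h
    have h0 : (N : F) = 0 := by
      have := congrArg WittVector.constantCoeff hw
      rwa [pow_succ, mul_assoc, map_mul, map_mul, map_natCast, map_natCast, CharP.cast_eq_zero F p, zero_mul,
        mul_zero] at this
    obtain ⟨m, rfl⟩ := (CharP.cast_eq_zero_iff F p N).1 h0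
    rw [pow_succ']
    refine mul_dvd_mul_left p (ih ⟨w, mul_left_cancel₀ (WittVector.p_nonzero p F) ?_⟩)
    rw [← mul_assoc, ← pow_succ', ← hw]
    push_cast
    ring

variable [Fintype F]

/-- Substituting at for t multiplies the sum by τ(a)^n, which is not 1 for a suitable a. -/
theorem WittVector.sum_teichmuller_pow_eq_zero {n : ℕ} (hn : ¬ Fintype.card F - 1 ∣ n) :
    ∑ t : F, WittVector.teichmuller p t ^ n = 0 := by
  rw [← FiniteField.forall_pow_eq_one_iff] at hn
  push Not at hn
  obtain ⟨a, ha⟩ := hn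
  have hmul : WittVector.teichmuller p (a : F) ^ n * ∑ t : F, WittVector.teichmuller p t ^ n =
      ∑ t : F, WittVector.teichmuller p t ^ n := by
    rw [mul_sum]
    refine Fintype.sum_equiv (Equiv.mulLeft₀ (a : F) a.ne_zero) _ _ fun t => ?_
    simp [mul_pow]
  have hne : WittVector.teichmuller p (a : F) ^ n ≠ 1 := fun h => ha <| by
    rw [← map_pow, ← map_one (WittVector.teichmuller p)] at h
    exact Units.ext (by simpa using WittVector.teichmuller_injective h)
  by_contra h
  exact hne (mul_right_cancel₀ h (hmul.trans (one_mul _).symm))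

/-- If p ∣ T, the exponent is at least n. Otherwise T^(q-1) ≡ 1 mod p, and each p-th power improves
the congruence by a factor p. -/
theorem WittVector.pow_dvd_sub_indicator [DecidableEq F] {q : ℕ} (hF : Fintype.card F = q)
    (T : WittVector p F) (n : ℕ) :
    (p : WittVector p F) ^ n ∣ (1 - T ^ ((q - 1) * p ^ n)) -
      (if WittVector.constantCoeff T = 0 then 1 else 0) := by
  have hq : 1 < q := hF ▸ Fintype.one_lt_card
  split_ifs with h
  · have h1 : n ≤ (q - 1) * p ^ n := by
      have := (Nat.lt_pow_self hp.out.one_lt : n < p ^ n)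
      have := Nat.le_mul_of_pos_left (p ^ n) (by omega : 0 < q - 1)
      omega
    have := (pow_dvd_pow _ h1).trans
      (pow_dvd_pow_of_dvd ((WittVector.natCast_prime_dvd_iff T).2 h) ((q - 1) * p ^ n))
    rw [sub_sub_cancel_left]
    exact this.neg_right
  · have h1 : (p : WittVector p F) ∣ 1 - T ^ (q - 1) := by
      rw [WittVector.natCast_prime_dvd_iff]
      rw [map_sub, map_one, map_pow, ← hF, FiniteField.pow_card_sub_one_eq_one _ h, sub_self]
    have := dvd_sub_pow_of_dvd_sub h1 n
    rw [one_pow, ← pow_mul] at this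
    rw [sub_zero]
    exact (pow_dvd_pow _ n.le_succ).trans this

end Witt

/-- The sum of the Teichmüller lifts of the terms of `f` at `x`. -/
noncomputable def teichmullerEval (p : ℕ) [Fact p.Prime] {F : Type*} [Field F] {k : ℕ}
    (f : MvPolynomial (Fin k) F) (x : Fin k → F) : WittVector p F :=
  ∑ u ∈ f.support, WittVector.teichmuller p (f.coeff u) *
    ∏ l, WittVector.teichmuller p (x l) ^ u l

/-! ### The divisibility half -/

section Divisibility

variable {p : ℕ} [hp : Fact p.Prime] {F : Type*} [Field F] {k : ℕ}

theorem constantCoeff_teichmullerEval (f : MvPolynomial (Fin k) F) (x : Fin k → F) :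
    WittVector.constantCoeff (teichmullerEval p f x) = MvPolynomial.eval x f := by
  have h : ∀ a : F, WittVector.constantCoeff (WittVector.teichmuller p a) = a :=
    WittVector.teichmuller_coeff_zero p
  rw [teichmullerEval, map_sum, MvPolynomial.eval_eq']
  simp only [map_mul, map_prod, map_pow, h]

variable [Fintype F]

theorem sum_teichmullerEval_pow (f : MvPolynomial (Fin k) F) (m : ℕ) :
    ∑ x : Fin k → F, teichmullerEval p f x ^ m =
      ∑ j ∈ f.support.piAntidiag m, (Nat.multinomial f.support j : WittVector p F) *
        (∏ u ∈ f.support, WittVector.teichmuller p (f.coeff u) ^ j u) *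
          ∏ l, ∑ t : F, WittVector.teichmuller p t ^ (∑ u ∈ f.support, j u * u l) := by
  simp only [teichmullerEval, sum_pow_eq_sum_piAntidiag]
  rw [sum_comm]
  refine sum_congr rfl fun j _ => ?_
  rw [← WittVector.sum_prod_teichmuller_pow, mul_sum]
  refine sum_congr rfl fun x _ => ?_
  rw [mul_assoc]
  congr 1
  simp only [mul_pow, prod_mul_distrib]
  congr 1
  simp only [← prod_pow, ← prod_pow_eq_pow_sum]
  rw [prod_comm]
  refine prod_congr rfl fun l _ => prod_congr rfl fun u _ => ?_
  rw [← pow_mul, mul_comm]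

variable [CharP F p]

theorem pow_dvd_sum_teichmullerEval_pow {e d n : ℕ} (he : 0 < e) (hF : Fintype.card F = p ^ e)
    (hd : 1 ≤ d) (f : MvPolynomial (Fin k) F) (hf : f.totalDegree = d)
    (r : ℕ) (hr : ∀ c, k ≤ d * c → r ≤ c) :
    (p : WittVector p F) ^ (e * (r - 1)) ∣
      ∑ x : Fin k → F, teichmullerEval p f x ^ ((p ^ e - 1) * p ^ n) := by
  rw [sum_teichmullerEval_pow]
  refine dvd_sum fun j hj => ?_
  by_cases hl : ∀ l, p ^ e - 1 ∣ ∑ u ∈ f.support, j u * u l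
  · have hu : ∀ u ∈ f.support, ∑ l, u l ≤ d := fun u hu => by
      rw [← hf]
      simpa [Finsupp.sum_fintype] using MvPolynomial.le_totalDegree hu
    have h := pow_dvd_multinomial_mul he hd f.support (fun u l => u l) hu j
      (mem_piAntidiag.1 hj).1 hl r hr
    have h' := Nat.cast_dvd_cast (α := WittVector p F) h
    have hZ := WittVector.card_pow_dvd_prod_sum_teichmuller_pow (p := p) (F := F)
      (fun l => ∑ u ∈ f.support, j u * u l)
    rw [hF] at hZ
    push_cast at h' hZ
    exact h'.trans (mul_dvd_mul (dvd_mul_right _ _) hZ)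
  · push Not at hl
    obtain ⟨l, hl⟩ := hl
    rw [prod_eq_zero (mem_univ l) (WittVector.sum_teichmuller_pow_eq_zero (hF ▸ hl)), mul_zero]
    exact dvd_zero _

theorem pow_dvd_numZeros {e d : ℕ} (he : 0 < e) (hF : Fintype.card F = p ^ e)
    (hd : 1 ≤ d) (f : MvPolynomial (Fin k) F) (hf : f.totalDegree = d)
    (r : ℕ) (hr : ∀ c, k ≤ d * c → r ≤ c) : p ^ (e * (r - 1)) ∣ numZeros f := by
  classical
  set n := e * (r - 1) with hn
  have hN : (numZeros f : WittVector p F) =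
      ∑ x : Fin k → F, if MvPolynomial.eval x f = 0 then 1 else 0 := by
    rw [numZeros, Nat.card_eq_fintype_card, Fintype.card_subtype, sum_boole]
  have hdiff : (p : WittVector p F) ^ n ∣
      ∑ x : Fin k → F, ((1 - teichmullerEval p f x ^ ((p ^ e - 1) * p ^ n)) -
        (if MvPolynomial.eval x f = 0 then 1 else 0)) := dvd_sum fun x _ => by
    rw [← constantCoeff_teichmullerEval (p := p)]
    exact WittVector.pow_dvd_sub_indicator hF _ n
  rw [sum_sub_distrib, sum_sub_distrib, ← hN] at hdiff
  have hone : (p : WittVector p F) ^ n ∣ ∑ _x : Fin k → F, 1 := by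
    -- The q^k points contribute a multiple of p^n, since c = k is admissible in `hr`.
    have : r ≤ k := hr k (Nat.le_mul_of_pos_left k hd)
    rw [sum_const, card_univ, Fintype.card_fun, hF, Fintype.card_fin, ← pow_mul, nsmul_one]
    push_cast
    exact pow_dvd_pow _ (Nat.mul_le_mul_left e (by omega))
  exact WittVector.pow_dvd_of_pow_dvd_natCast (F := F)
    ((dvd_sub_right (dvd_sub hone (pow_dvd_sum_teichmullerEval_pow he hF hd f hf r hr))).1 hdiff)

end Divisibility

/-! ### Tools for the sharp examples -/

theorem emultiplicity_pow_mul_of_not_dvd {p : ℕ} (hp : p.Prime) (n : ℕ) {b : ℕ} (hb : ¬ p ∣ b) :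
    emultiplicity p (p ^ n * b) = n := by
  rw [emultiplicity_eq_coe]
  refine ⟨dvd_mul_right _ _, fun h => hb ?_⟩
  rw [pow_succ] at h
  exact Nat.dvd_of_mul_dvd_mul_left (Nat.pow_pos hp.pos) h

theorem exists_fin_totalDegree_numZeros {F σ : Type*} [Field F] [Fintype σ] {k : ℕ}
    (hσ : Fintype.card σ = k) (f : MvPolynomial σ F) :
    ∃ g : MvPolynomial (Fin k) F, g.totalDegree = f.totalDegree ∧
      numZeros g = Nat.card {x : σ → F // MvPolynomial.eval x f = 0} := by
  let E : σ ≃ Fin k := Fintype.equivFinOfCardEq hσ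
  refine ⟨MvPolynomial.renameEquiv F E f, MvPolynomial.totalDegree_renameEquiv E f, ?_⟩
  refine Nat.card_congr (Equiv.subtypeEquiv (E.symm.arrowCongr (Equiv.refl F)) fun x => ?_)
  rw [MvPolynomial.renameEquiv_apply, MvPolynomial.eval_rename]
  rfl

/-- Supplies the block sizes; the full block 0 makes the degree exactly D + 1. -/
theorem exists_bounded_composition (D n r : ℕ) (hn : n ≤ (r + 1) * D) (hD : D ≤ n) :
    ∃ m : Fin (r + 1) → ℕ, (∀ i, m i ≤ D) ∧ ∑ i, m i = n ∧ m 0 = D := by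
  have aux : ∀ r n, n ≤ r * D → ∃ m : Fin r → ℕ, (∀ i, m i ≤ D) ∧ ∑ i, m i = n := by
    intro r
    induction r with
    | zero => exact fun n hn => ⟨fun _ => 0, by simp, by simp at hn; simp [hn]⟩
    | succ r ih =>
      intro n hn
      rw [add_mul, one_mul] at hn
      obtain ⟨m, hm, hs⟩ := ih (n - min n D) (by omega)
      refine ⟨Fin.cons (min n D) m, fun i => ?_, ?_⟩
      · refine Fin.cases ?_ (fun i => ?_) i
        · simp
        · simpa using hm i
      · rw [Fin.sum_univ_succ]
        simp only [Fin.cons_zero, Fin.cons_succ, hs]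
        omega
  rw [add_mul, one_mul] at hn
  obtain ⟨m, hm, hs⟩ := aux r (n - D) (by omega)
  refine ⟨Fin.cons D m, fun i => ?_, ?_, rfl⟩
  · refine Fin.cases ?_ (fun i => ?_) i
    · simp
    · simpa using hm i
  · rw [Fin.sum_univ_succ]
    simp only [Fin.cons_zero, Fin.cons_succ, hs]
    omega

section Counting

variable {F : Type*} [Field F] [Fintype F]

theorem card_linear_form_zeros {r : ℕ} {c : Fin r → F} (hc : c ≠ 0) :
    Nat.card {y : Fin r → F // ∑ i, y i * c i = 0} = Fintype.card F ^ (r - 1) := by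
  classical
  let φ : (Fin r → F) →ₗ[F] F := ∑ i, (LinearMap.proj i).smulRight (c i)
  have hφ : ∀ y, φ y = ∑ i, y i * c i := fun y => by simp [φ]
  have hsurj : LinearMap.range φ = ⊤ := by
    obtain ⟨i, hi⟩ := Function.ne_iff.1 hc
    rw [LinearMap.range_eq_top]
    intro a
    refine ⟨Pi.single i (a / c i), ?_⟩
    rw [hφ, sum_eq_single i (fun j _ hj => by simp [hj]) (by simp)]
    simpa using div_mul_cancel₀ a hi
  have hfin := LinearMap.finrank_range_add_finrank_ker φ
  rw [hsurj, finrank_top, Module.finrank_self, Module.finrank_fin_fun] at hfin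
  have hker : Nat.card {y : Fin r → F // ∑ i, y i * c i = 0} = Nat.card (LinearMap.ker φ) :=
    Nat.card_congr (Equiv.subtypeEquivRight fun y => by rw [LinearMap.mem_ker, hφ])
  rw [hker, Module.natCard_eq_pow_finrank (K := F), Nat.card_eq_fintype_card]
  congr 1
  omega

theorem card_prod_eq_zero_add (m : ℕ) :
    Nat.card {w : Fin m → F // ∏ j, w j = 0} + (Fintype.card F - 1) ^ m = Fintype.card F ^ m := by
  classical
  have hne : Nat.card {w : Fin m → F // ¬ ∏ j, w j = 0} = (Fintype.card F - 1) ^ m := by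
    have h1 : Nat.card {w : Fin m → F // ¬ ∏ j, w j = 0} = Nat.card (Fin m → {a : F // a ≠ 0}) :=
      Nat.card_congr ((Equiv.subtypeEquivRight fun w => by simp [prod_eq_zero_iff]).trans
        (Equiv.subtypePiEquivPi (p := fun _ (a : F) => a ≠ 0)))
    rw [h1, Nat.card_fun, Nat.card_eq_fintype_card, Nat.card_eq_fintype_card, Fintype.card_fin,
      Fintype.card_subtype_compl, Fintype.card_subtype_eq]
  rw [← hne, ← Nat.card_sum, Nat.card_congr (Equiv.sumCompl _), Nat.card_fun,
    Nat.card_eq_fintype_card, Nat.card_eq_fintype_card, Fintype.card_fin]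

/-- In F the count q^m - (q-1)^m becomes -(-1)^m. -/
theorem cast_card_prod_eq_zero_ne_zero {m : ℕ} (hm : m ≠ 0) :
    (Nat.card {w : Fin m → F // ∏ j, w j = 0} : F) ≠ 0 := by
  intro h
  have := congrArg (Nat.cast : ℕ → F) (card_prod_eq_zero_add (F := F) m)
  rw [Nat.cast_add, h, Nat.cast_pow, Nat.cast_sub Fintype.card_pos, Nat.cast_pow,
    FiniteField.cast_card_eq_zero, zero_pow hm] at this
  simp at this

theorem cast_card_common_zeros_ne_zero {r : ℕ} (m : Fin r → ℕ) :
    (Nat.card {z : (Σ i, Fin (m i)) → F // ∀ i, m i ≠ 0 → ∏ j, z ⟨i, j⟩ = 0} : F) ≠ 0 := by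
  have h1 : Nat.card {z : (Σ i, Fin (m i)) → F // ∀ i, m i ≠ 0 → ∏ j, z ⟨i, j⟩ = 0} =
      ∏ i, Nat.card {w : Fin (m i) → F // m i ≠ 0 → ∏ j, w j = 0} := by
    rw [← Nat.card_pi]
    refine Nat.card_congr (Equiv.trans (Equiv.subtypeEquiv
      (q := fun w : (i : Fin r) → Fin (m i) → F => ∀ i, m i ≠ 0 → ∏ j, w i j = 0)
      (Equiv.piCurry fun _ _ => F) fun z => Iff.rfl)
      (Equiv.subtypePiEquivPi (p := fun i (w : Fin (m i) → F) => m i ≠ 0 → ∏ j, w j = 0)))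
  rw [h1, Nat.cast_prod, prod_ne_zero_iff]
  intro i _
  by_cases hi : m i = 0
  · have : Nat.card {w : Fin (m i) → F // m i ≠ 0 → ∏ j, w j = 0} = 1 := by
      rw [Nat.card_congr (Equiv.subtypeUnivEquiv fun w h => absurd hi h), Nat.card_fun]
      simp [hi]
    rw [this, Nat.cast_one]
    exact one_ne_zero
  · rw [Nat.card_congr (Equiv.subtypeEquivRight fun w => by simp [hi] :
      _ ≃ {w : Fin (m i) → F // ∏ j, w j = 0})]
    exact cast_card_prod_eq_zero_ne_zero hi

end Counting

/-- The sum of the monomials `y i * ∏ j, z (i, j)` over the blocks `i` that contain some `z`. -/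
noncomputable def blockPolynomial (F : Type*) [Field F] {r : ℕ} (m : Fin r → ℕ) :
    MvPolynomial (Fin r ⊕ Σ i, Fin (m i)) F :=
  -- An empty block would give the bare y_i, whose coefficient 1 never vanishes; there would be no
  -- exceptional fibres and N would be too divisible.
  ∑ i, if m i = 0 then 0 else
    MvPolynomial.X (Sum.inl i) * ∏ j, MvPolynomial.X (Sum.inr ⟨i, j⟩)

theorem totalDegree_blockPolynomial {F : Type*} [Field F] {r D : ℕ} (m : Fin r → ℕ)
    (hm : ∀ i, m i ≤ D) (hD : D ≠ 0) (i₀ : Fin r) (hi₀ : m i₀ = D) :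
    (blockPolynomial F m).totalDegree = D + 1 := by
  classical
  apply le_antisymm
  · refine MvPolynomial.totalDegree_finsetSum_le fun i _ => ?_
    split_ifs
    · simp
    · refine (MvPolynomial.totalDegree_mul _ _).trans ?_
      have h1 := MvPolynomial.totalDegree_finsetProd (R := F) univ
        fun j : Fin (m i) => (MvPolynomial.X (Sum.inr ⟨i, j⟩) :
          MvPolynomial (Fin r ⊕ Σ i, Fin (m i)) F)
      simp only [MvPolynomial.totalDegree_X, sum_const, card_univ, Fintype.card_fin, smul_eq_mul,
        mul_one] at h1 ⊢
      have := hm i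
      omega
  · let v : Fin r → (Fin r ⊕ Σ i, Fin (m i)) →₀ ℕ := fun i =>
      Finsupp.single (Sum.inl i) 1 + ∑ j, Finsupp.single (Sum.inr ⟨i, j⟩) 1
    have hv : ∀ i, (MvPolynomial.X (Sum.inl i) * ∏ j, MvPolynomial.X (Sum.inr ⟨i, j⟩) :
        MvPolynomial (Fin r ⊕ Σ i, Fin (m i)) F) = MvPolynomial.monomial (v i) 1 := fun i => by
      simp only [v, MvPolynomial.X]
      rw [← MvPolynomial.monomial_sum_one, MvPolynomial.monomial_mul, one_mul]
    -- The variable y_i identifies its block, so monomials cannot cancel.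
    have hinj : ∀ i, v i = v i₀ → i = i₀ := fun i h => by
      have := DFunLike.congr_fun h (Sum.inl i)
      by_contra hne
      simp [v, Ne.symm hne] at this
    have hcoeff : (blockPolynomial F m).coeff (v i₀) = 1 := by
      rw [blockPolynomial, MvPolynomial.coeff_sum, sum_eq_single i₀]
      · rw [if_neg (by omega), hv, MvPolynomial.coeff_monomial, if_pos rfl]
      · intro i _ hi
        split_ifs
        · simp
        · rw [hv, MvPolynomial.coeff_monomial, if_neg fun h => hi (hinj i h)]
      · simp
    have hdeg := MvPolynomial.le_totalDegree (p := blockPolynomial F m) (s := v i₀) (by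
      rw [MvPolynomial.mem_support_iff, hcoeff]
      exact one_ne_zero)
    refine le_trans (le_of_eq ?_) hdeg
    change D + 1 = (v i₀).degree
    simp [v, hi₀, add_comm]

theorem card_zeros_blockPolynomial {F : Type*} [Field F] [Fintype F] {r : ℕ} (hr : 0 < r)
    (m : Fin r → ℕ) :
    Nat.card {x : (Fin r ⊕ Σ i, Fin (m i)) → F // MvPolynomial.eval x (blockPolynomial F m) = 0} =
      Fintype.card F ^ (r - 1) * (Fintype.card F ^ (∑ i, m i) + (Fintype.card F - 1) *
        Nat.card {z : (Σ i, Fin (m i)) → F // ∀ i, m i ≠ 0 → ∏ j, z ⟨i, j⟩ = 0}) := by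
  classical
  let c : ((Σ i, Fin (m i)) → F) → Fin r → F := fun z i =>
    if m i = 0 then 0 else ∏ j, z ⟨i, j⟩
  have heval : ∀ x, MvPolynomial.eval x (blockPolynomial F m) =
      ∑ i, x (Sum.inl i) * c (fun s => x (Sum.inr s)) i := fun x => by
    rw [blockPolynomial, map_sum]
    refine sum_congr rfl fun i _ => ?_
    simp only [c]
    split_ifs <;> simp
  have hc : ∀ z, c z = 0 ↔ ∀ i, m i ≠ 0 → ∏ j, z ⟨i, j⟩ = 0 := fun z => by
    rw [funext_iff]
    refine forall_congr' fun i => ?_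
    by_cases hi : m i = 0 <;> simp [c, hi]
  have hfib : ∀ z, Nat.card {y : Fin r → F // ∑ i, y i * c z i = 0} =
      Fintype.card F ^ (r - 1) + if c z = 0 then
        Fintype.card F ^ (r - 1) * (Fintype.card F - 1) else 0 := fun z => by
    split_ifs with h
    · simp only [h, Pi.zero_apply, mul_zero, sum_const_zero]
      rw [Nat.card_congr (Equiv.subtypeUnivEquiv fun _ => trivial), Nat.card_fun,
        Nat.card_eq_fintype_card, Nat.card_eq_fintype_card, Fintype.card_fin, ← mul_one_add,
        Nat.add_sub_cancel' Fintype.one_lt_card.le, ← pow_succ, Nat.sub_add_cancel hr]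
    · rw [card_linear_form_zeros h, add_zero]
  have hcount : Nat.card {x : (Fin r ⊕ Σ i, Fin (m i)) → F //
      MvPolynomial.eval x (blockPolynomial F m) = 0} =
      ∑ z, Nat.card {y : Fin r → F // ∑ i, y i * c z i = 0} := by
    rw [← Nat.card_sigma]
    refine Nat.card_congr ⟨fun x => ⟨fun s => x.1 (Sum.inr s), fun i => x.1 (Sum.inl i), ?_⟩,
      fun w => ⟨Sum.elim w.2.1 w.1, ?_⟩, fun x => ?_, fun w => rfl⟩
    · rw [← heval]
      exact x.2
    · rw [heval]
      exact w.2.2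
    · ext s
      rcases s with s | s <;> rfl
  rw [hcount, sum_congr rfl fun z _ => hfib z, sum_add_distrib, ← sum_filter, sum_const, sum_const,
    card_univ, Fintype.card_fun, Nat.card_eq_fintype_card, Fintype.card_subtype]
  simp only [hc, Fintype.card_sigma, Fintype.card_fin, smul_eq_mul]
  ring

/-! ### Extremal polynomials for k < d, d = 1 and 2 ≤ d ≤ k -/

section Sharpness

variable {p e k d r : ℕ} {F : Type*} [Field F] [Fintype F]

theorem exists_sharp_of_lt [CharP F p] (hk : 1 ≤ k) (hkd : k < d) :
    ∃ f : MvPolynomial (Fin k) F, f.totalDegree = d ∧ emultiplicity p (numZeros f) = 0 := by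
  let i₀ : Fin k := ⟨0, hk⟩
  refine ⟨MvPolynomial.X i₀ ^ (d - k) * ∏ l, MvPolynomial.X l, ?_, ?_⟩
  · have : (MvPolynomial.X i₀ ^ (d - k) * ∏ l, MvPolynomial.X l : MvPolynomial (Fin k) F) =
        MvPolynomial.monomial (Finsupp.single i₀ (d - k) + ∑ l, Finsupp.single l 1) 1 := by
      rw [MvPolynomial.X_pow_eq_monomial]
      simp only [MvPolynomial.X]
      rw [← MvPolynomial.monomial_sum_one, MvPolynomial.monomial_mul, one_mul]
    rw [this, MvPolynomial.totalDegree_monomial _ one_ne_zero]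
    change Finsupp.degree _ = d
    simp only [map_add, map_sum, Finsupp.degree_single, sum_const, card_univ, Fintype.card_fin,
      smul_eq_mul, mul_one]
    omega
  · have hN : numZeros (MvPolynomial.X i₀ ^ (d - k) * ∏ l, MvPolynomial.X l :
        MvPolynomial (Fin k) F) = Nat.card {w : Fin k → F // ∏ j, w j = 0} := by
      refine Nat.card_congr (Equiv.subtypeEquivRight fun x => ?_)
      simp only [map_mul, map_pow, map_prod, MvPolynomial.eval_X, mul_eq_zero]
      refine or_iff_right_of_imp fun h => prod_eq_zero (mem_univ i₀) ?_
      exact eq_zero_of_pow_eq_zero h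
    rw [hN, emultiplicity_eq_zero, ← CharP.cast_eq_zero_iff F p]
    exact cast_card_prod_eq_zero_ne_zero (by omega)

theorem exists_sharp_of_degree_one [hp : Fact p.Prime] (hF : Fintype.card F = p ^ e)
    (hk : 1 ≤ k) :
    ∃ f : MvPolynomial (Fin k) F, f.totalDegree = 1 ∧
      emultiplicity p (numZeros f) = (e * (k - 1) : ℕ) := by
  let i₀ : Fin k := ⟨0, hk⟩
  refine ⟨MvPolynomial.X i₀, MvPolynomial.totalDegree_X _, ?_⟩
  have hN : numZeros (MvPolynomial.X i₀ : MvPolynomial (Fin k) F) = Fintype.card F ^ (k - 1) := by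
    rw [← card_linear_form_zeros (c := Pi.single i₀ (1 : F)) (by simp)]
    exact Nat.card_congr (Equiv.subtypeEquivRight fun x => by simp [Pi.single_apply])
  rw [hN, hF, ← pow_mul, ← mul_one (p ^ _)]
  exact emultiplicity_pow_mul_of_not_dvd hp.out _ hp.out.not_dvd_one

theorem exists_sharp_of_le [hp : Fact p.Prime] [CharP F p] (hF : Fintype.card F = p ^ e)
    (hd : 2 ≤ d) (hdk : d ≤ k)
    (hr : 1 ≤ r) (hkr : k ≤ d * r) (hrk : d * (r - 1) < k) :
    ∃ f : MvPolynomial (Fin k) F, f.totalDegree = d ∧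
      emultiplicity p (numZeros f) = (e * (r - 1) : ℕ) := by
  obtain ⟨D, rfl⟩ : ∃ D, d = D + 1 := ⟨d - 1, by omega⟩
  obtain ⟨r, rfl⟩ : ∃ s, r = s + 1 := ⟨r - 1, by omega⟩
  rw [Nat.add_sub_cancel] at hrk
  -- From here r + 1 is the number of blocks; there is room for all the y_i and one full block.
  have hlow : r + 1 + D ≤ k := by
    rcases Nat.eq_zero_or_pos r with rfl | h
    · omega
    · nlinarith [Nat.mul_le_mul_left D h]
  have hup : k - (r + 1) ≤ (r + 1) * D := by
    rw [tsub_le_iff_right]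
    exact hkr.trans_eq (by ring)
  obtain ⟨m, hm, hs, hm0⟩ := exists_bounded_composition D (k - (r + 1)) r hup (by omega)
  obtain ⟨g, hg, hN⟩ := exists_fin_totalDegree_numZeros (k := k) (by
    rw [Fintype.card_sum, Fintype.card_sigma]
    simp only [Fintype.card_fin, hs]
    omega) (blockPolynomial F m)
  refine ⟨g, hg.trans (totalDegree_blockPolynomial m hm (by omega) 0 hm0), ?_⟩
  rw [hN, card_zeros_blockPolynomial (by omega), hs]
  -- Modulo p the first term dies, its exponent being at least D ≥ 1, and q - 1 becomes -1.
  have hB : ¬ p ∣ Fintype.card F ^ (k - (r + 1)) + (Fintype.card F - 1) *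
      Nat.card {z : (Σ i, Fin (m i)) → F // ∀ i, m i ≠ 0 → ∏ j, z ⟨i, j⟩ = 0} := by
    rw [← CharP.cast_eq_zero_iff F p, Nat.cast_add, Nat.cast_mul, Nat.cast_pow,
      Nat.cast_sub Fintype.card_pos, FiniteField.cast_card_eq_zero, zero_pow (by omega)]
    simpa using cast_card_common_zeros_ne_zero m
  rw [show Fintype.card F ^ (r + 1 - 1) = p ^ (e * (r + 1 - 1)) by rw [hF, ← pow_mul]]
  exact emultiplicity_pow_mul_of_not_dvd hp.out _ hB

end Sharpness

/-- A finite `emultiplicity` already entails N ≠ 0, and e ≥ 1 follows from F having more than one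
element. -/
theorem mainTheorem9 {F : Type*} [Field F] [Fintype F] (p e q : ℕ) (hp : p.Prime)
    (hq : q = p ^ e) (hF : Fintype.card F = q) (k d : ℕ) (hk : 1 ≤ k) (hd : 1 ≤ d) :
    (∀ f : MvPolynomial (Fin k) F, f.totalDegree = d →
      q ^ (⌈(k : ℚ) / (d : ℚ)⌉₊ - 1) ∣ numZeros f) ∧
    (∃ f : MvPolynomial (Fin k) F, f.totalDegree = d ∧
      emultiplicity p (numZeros f) = ((e * (⌈(k : ℚ) / (d : ℚ)⌉₊ - 1) : ℕ) : ℕ∞)) := by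
  subst hq
  have : Fact p.Prime := ⟨hp⟩
  have he : 0 < e := by
    rcases Nat.eq_zero_or_pos e with rfl | h
    · have := Fintype.one_lt_card (α := F)
      simp [hF] at this
    · exact h
  have : CharP F p := by
    have h := FiniteField.cast_card_eq_zero F
    rw [hF, Nat.cast_pow] at h
    exact (CharP.charP_iff_prime_eq_zero hp).2 (eq_zero_of_pow_eq_zero h)
  have hceil : ∀ c, ⌈(k : ℚ) / (d : ℚ)⌉₊ ≤ c ↔ k ≤ d * c := fun c => by
    rw [Nat.ceil_le, div_le_iff₀ (by exact_mod_cast hd), mul_comm]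
    exact_mod_cast Iff.rfl
  generalize ⌈(k : ℚ) / (d : ℚ)⌉₊ = r at hceil
  have hr : 1 ≤ r := by
    by_contra h
    have := (hceil 0).1 (by omega)
    omega
  refine ⟨fun f hf => ?_, ?_⟩
  · rw [← pow_mul]
    exact pow_dvd_numZeros he hF hd f hf r fun c hc => (hceil c).2 hc
  · have hkr : k ≤ d * r := (hceil r).1 le_rfl
    have hrk : d * (r - 1) < k := by
      by_contra h
      have := (hceil (r - 1)).2 (by omega)
      omega
    rcases lt_or_ge k d with hkd | hdk
    · obtain ⟨f, hf, hN⟩ := exists_sharp_of_lt (p := p) (F := F) hk hkd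
      have : r ≤ 1 := (hceil 1).2 (by omega)
      exact ⟨f, hf, by rw [hN, Nat.sub_eq_zero_of_le this]; simp⟩
    · rcases hd.eq_or_lt with rfl | hd2
      · rw [show r = k by omega]
        exact exists_sharp_of_degree_one hF hk
      · exact exists_sharp_of_le hF hd2 hdk hr hkr hrk
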